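/- Let $q\colon X\to Q$ be an open map of locales, i.e. $q^{-1}\colon \mathcal{O}Q\to\mathcal{O}X$ has a left adjoint $q_!$ satisfying Frobenius reciprocity $q_!(U\wedge q^{-1}(V))=q_!(U)\wedge V$. A localic relation on $X$ is a sublocale $r\colon R\rightarrowtail X\times X$, with source and target maps $s=\mathrm{pr}_1\circ r$ and $t=\mathrm{pr}_2\circ r$. It has open cones if $s$ and $t$ are open; its cones are then $\Uparrow_R:=t_!s^{-1}$ and $\Downarrow_R:=s_!t^{-1}$. For functions $u,d\colon\mathcal{O}X\to\mathcal{O}X$ let $R_{u,d}$ be the localic relation on $X$ whose frame is the quotient of $\mathcal{O}X\otimes\mathcal{O}X$ by the frame congruence generated by the relation $\sim$ on rectangles given by $a\otimes b\sim c\otimes d'$ if $u(a)\wedge b=u(c)\wedge d'$ and $a\wedge d(b)=c\wedge d(d')$. Let $\mathsf{Cone}\dashv\mathsf{Rel}$ be the adjunction between - the category of locales with an open cone relation $(X,R)$, whose morphisms $(X,R)\to(Y,S)$ are the locale maps $f\colon X\to Y$ such that $f\times f$ restricts to a map $R\to S$, and - the opposite of the category of conic frames $(L,u,d)$, that is, frames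 $L$ with join-preserving functions $u,d\colon L\to L$ satisfying $u(x)\wedge y\le u(x\wedge d(y))$ and $x\wedge d(y)\le d(u(x)\wedge y)$, whose morphisms $(L,u,d)\to(L',u',d')$ are the frame maps $h\colon L\to L'$ with $u'h\le hu$ and $d'h\le hd$, where $\mathsf{Cone}(X,R)=(\mathcal{O}X,\Uparrow_R,\Downarrow_R)$ and $\mathsf{Rel}(\mathcal{O}X,u,d)=(X,R_{u,d})$, and both functors act on morphisms by $f\leftrightarrow f^{-1}$. The unit at $(X,R)$ is carried by $\mathrm{id}_X$. Then the kernel pair $K:=X\times_Q X\rightarrowtail X\times X$ has open cones, and $\Uparrow_K=\Downarrow_K=q^{-1}q_!$. Moreover, $(X,K)$ is a fixed point of the adjunction $\mathsf{Cone}\dashv\mathsf{Rel}$, meaning that the unit at $(X,K)$ is an isomorphism; equivalently, $K$ and $R_{\Uparrow_K,\Downarrow_K}$ are the same sublocale of $X\times X$. -/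

import Mathlib

open CategoryTheory

universe u

namespace Localic

/-! ## Sublocales generated by a binary relation -/

section Saturated

variable {L M : Type*} [Order.Frame L] [Order.Frame M]

/-- The sublocale `L/∼` of saturated elements of a binary relation `∼` on a frame. -/
def saturated (r : L → L → Prop) : Sublocale L where
  carrier := {s | ∀ a b c, r a b → (a ⊓ c ≤ s ↔ b ⊓ c ≤ s)}
  sInf_mem' S hS a b c hab := by
    simp only [le_sInf_iff]
    exact forall₂_congr fun s hs => hS hs a b c hab
  himp_mem' x s hs a b c hab := by
    simp only [le_himp_iff, inf_assoc]
    exact hs a b (c ⊓ x) hab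

theorem mem_saturated {r : L → L → Prop} {s : L} :
    s ∈ saturated r ↔ ∀ a b c, r a b → (a ⊓ c ≤ s ↔ b ⊓ c ≤ s) := Iff.rfl

theorem restrict_le_iff (S : Sublocale L) (x : L) (s : S) : S.restrict x ≤ s ↔ x ≤ (s : L) :=
  S.giRestrict.gc x s

theorem restrict_coe (S : Sublocale L) (s : S) : S.restrict (s : L) = s :=
  S.giRestrict.l_u_eq s

/-- The quotient map identifies related elements. -/
theorem restrict_saturated_eq {r : L → L → Prop} {a b : L} (h : r a b) :
    (saturated r).restrict a = (saturated r).restrict b := by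
  refine eq_of_forall_ge_iff fun s => ?_
  rw [restrict_le_iff, restrict_le_iff]
  simpa using s.2 a b ⊤ h

/-- A frame map that does not distinguish `x` from its closure factors through a sublocale. -/
def factor (S : Sublocale L) (h : FrameHom L M) (hS : ∀ x, h (S.restrict x : L) = h x) :
    FrameHom S M where
  toFun s := h s
  map_inf' a b := by simp
  map_top' := map_top h
  map_sSup' T := by
    have : sSup T = S.restrict (sSup ((fun s : S => (s : L)) '' T)) := by
      rw [map_sSup, Set.image_image]
      simp
    rw [this, hS, map_sSup, Set.image_image]

theorem factor_restrict (S : Sublocale L) (h : FrameHom L M)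
    (hS : ∀ x, h (S.restrict x : L) = h x) : (factor S h hS).comp S.restrict = h := by
  ext x
  exact hS x

theorem apply_restrict_saturated (r : L → L → Prop) (h : FrameHom L M)
    (hr : ∀ a b, r a b → h a = h b) (x : L) : h ((saturated r).restrict x : L) = h x := by
  have gc : GaloisConnection h (fun y => sSup {x | h x ≤ y}) := by
    intro x y
    refine ⟨fun hx => le_sSup hx, fun hx => (OrderHomClass.mono h hx).trans ?_⟩
    rw [map_sSup]
    exact sSup_le (by rintro _ ⟨z, hz, rfl⟩; exact hz)
  refine le_antisymm ?_ (OrderHomClass.mono h ?_)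
  · have hm : sSup {z | h z ≤ h x} ∈ saturated r := by
      intro a b c hab
      rw [← gc, ← gc, map_inf, map_inf, hr a b hab]
    have := (restrict_le_iff (saturated r) x ⟨_, hm⟩).2 ((gc _ _).1 le_rfl)
    exact (gc _ _).2 this
  · exact (restrict_le_iff _ _ _).1 le_rfl

theorem restrict_hom_ext (S : Sublocale L) {f g : FrameHom S M}
    (h : ∀ x, f (S.restrict x) = g (S.restrict x)) : f = g := by
  ext s
  simpa [restrict_coe] using h s

end Saturated

/-! ## Binary coproducts of frames -/

section Coprod

variable {L M N : Type*} [Order.Frame L] [Order.Frame M] [Order.Frame N]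

/-- The lower sets of `L × M` that are closed under joins in each coordinate. -/
def coprodSublocale (L M : Type*) [Order.Frame L] [Order.Frame M] :
    Sublocale (LowerSet (L × M)) where
  carrier := {D | (∀ (S : Set L) (y : M), (∀ x ∈ S, (x, y) ∈ D) → (sSup S, y) ∈ D) ∧
    ∀ (x : L) (S : Set M), (∀ y ∈ S, (x, y) ∈ D) → (x, sSup S) ∈ D}
  sInf_mem' T hT := by
    constructor
    · intro S y h
      simp only [LowerSet.mem_sInf_iff] at h ⊢
      exact fun D hD => (hT hD).1 S y fun x hx => h x hx D hD
    · intro x S h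
      simp only [LowerSet.mem_sInf_iff] at h ⊢
      exact fun D hD => (hT hD).2 x S fun y hy => h y hy D hD
  himp_mem' A D hD := by
    have key : ∀ p : L × M, p ∈ A ⇨ D ↔ ∀ q ≤ p, q ∈ A → q ∈ D := by
      intro p
      rw [← LowerSet.Iic_le, le_himp_iff]
      exact ⟨fun h q hq hA => h ⟨hq, hA⟩, fun h q hq => h q hq.1 hq.2⟩
    constructor
    · intro S y h
      rw [key]
      rintro ⟨a, b⟩ ⟨ha, hb⟩ hA
      have hab : a = sSup ((fun x => a ⊓ x) '' S) := by
        rw [sSup_image, ← inf_sSup_eq]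
        exact (inf_eq_left.2 ha).symm
      rw [hab]
      refine hD.1 _ _ ?_
      rintro _ ⟨x, hx, rfl⟩
      exact (key _).1 (h x hx) _ ⟨inf_le_right, hb⟩ 
        (A.lower (show (a ⊓ x, b) ≤ (a, b) from ⟨inf_le_left, le_rfl⟩) hA)
    · intro x S h
      rw [key]
      rintro ⟨a, b⟩ ⟨ha, hb⟩ hA
      have hab : b = sSup ((fun y => b ⊓ y) '' S) := by
        rw [sSup_image, ← inf_sSup_eq]
        exact (inf_eq_left.2 hb).symm
      rw [hab]
      refine hD.2 _ _ ?_
      rintro _ ⟨y, hy, rfl⟩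
      exact (key _).1 (h y hy) _ ⟨ha, inf_le_right⟩ 
        (A.lower (show (a, b ⊓ y) ≤ (a, b) from ⟨le_rfl, inf_le_left⟩) hA)

/-- The coproduct `L ⊗ M` of two frames. -/
abbrev FrameCoprod (L M : Type*) [Order.Frame L] [Order.Frame M] : Type _ :=
  ↥(coprodSublocale L M)

/-- The basic rectangle `x ⊗ y`. -/
def rect (x : L) (y : M) : FrameCoprod L M :=
  (coprodSublocale L M).restrict (LowerSet.Iic (x, y))

theorem rect_le_iff {x : L} {y : M} {D : FrameCoprod L M} :
    rect x y ≤ D ↔ (x, y) ∈ (D : LowerSet (L × M)) := by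
  rw [rect, restrict_le_iff, LowerSet.Iic_le]

theorem eq_sSup_rect (D : FrameCoprod L M) :
    D = sSup ((fun p : L × M => rect p.1 p.2) '' (D : LowerSet (L × M))) := by
  apply le_antisymm
  · intro p hp
    have : rect p.1 p.2 ≤ sSup ((fun p : L × M => rect p.1 p.2) '' (D : LowerSet (L × M))) :=
      le_sSup ⟨p, hp, rfl⟩
    exact rect_le_iff.1 this
  · refine sSup_le ?_
    rintro _ ⟨p, hp, rfl⟩
    exact rect_le_iff.2 hp

theorem rect_mono {x x' : L} {y y' : M} (hx : x ≤ x') (hy : y ≤ y') : rect x y ≤ rect x' y' :=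
  rect_le_iff.2 ((rect x' y' : LowerSet (L × M)).lower ⟨hx, hy⟩ (rect_le_iff.1 le_rfl))

theorem rect_inf_rect (x x' : L) (y y' : M) :
    rect x y ⊓ rect x' y' = rect (x ⊓ x') (y ⊓ y') := by
  rw [rect, rect, rect, ← map_inf]
  congr 1
  ext p
  simp [Prod.le_def]

theorem rect_top_top : rect (⊤ : L) (⊤ : M) = ⊤ := by
  have : LowerSet.Iic ((⊤ : L), (⊤ : M)) = ⊤ := LowerSet.Iic_top
  rw [rect, this, map_top]

theorem sSup_rect_left (S : Set L) (y : M) :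
    rect (sSup S) y = sSup ((fun x => rect x y) '' S) := by
  apply le_antisymm
  · rw [rect_le_iff]
    refine (sSup ((fun x => rect x y) '' S)).2.1 S y fun x hx => ?_
    exact rect_le_iff.1 (le_sSup ⟨x, hx, rfl⟩)
  · refine sSup_le ?_
    rintro _ ⟨x, hx, rfl⟩
    exact rect_mono (le_sSup hx) le_rfl

theorem sSup_rect_right (x : L) (S : Set M) :
    rect x (sSup S) = sSup ((fun y => rect x y) '' S) := by
  apply le_antisymm
  · rw [rect_le_iff]
    refine (sSup ((fun y => rect x y) '' S)).2.2 x S fun y hy => ?_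
    exact rect_le_iff.1 (le_sSup ⟨y, hy, rfl⟩)
  · refine sSup_le ?_
    rintro _ ⟨y, hy, rfl⟩
    exact rect_mono le_rfl (le_sSup hy)

/-- The coproduct injection `x ↦ x ⊗ ⊤`. -/
def inlHom (L M : Type*) [Order.Frame L] [Order.Frame M] : FrameHom L (FrameCoprod L M) where
  toFun x := rect x ⊤
  map_inf' a b := by rw [rect_inf_rect, inf_idem]
  map_top' := rect_top_top
  map_sSup' S := sSup_rect_left S ⊤

/-- The coproduct injection `y ↦ ⊤ ⊗ y`. -/
def inrHom (L M : Type*) [Order.Frame L] [Order.Frame M] : FrameHom M (FrameCoprod L M) where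
  toFun y := rect ⊤ y
  map_inf' a b := by rw [rect_inf_rect, inf_idem]
  map_top' := rect_top_top
  map_sSup' S := sSup_rect_right ⊤ S

theorem inlHom_apply (x : L) : inlHom L M x = rect x ⊤ := rfl

theorem inrHom_apply (y : M) : inrHom L M y = rect ⊤ y := rfl

theorem rect_eq (x : L) (y : M) : rect x y = inlHom L M x ⊓ inrHom L M y := by
  rw [inlHom_apply, inrHom_apply, rect_inf_rect, inf_top_eq, top_inf_eq]

/-- The join-preserving extension of a function of two variables to the coproduct. -/
def biext (β : L → M → N) (D : FrameCoprod L M) : N :=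
  sSup ((fun p : L × M => β p.1 p.2) '' (D : LowerSet (L × M)))

/-- A function preserving joins in each variable extends along rectangles to a left adjoint. -/
theorem biext_gc (β : L → M → N) (h₁ : ∀ S y, β (sSup S) y = sSup ((fun x => β x y) '' S))
    (h₂ : ∀ x S, β x (sSup S) = sSup (β x '' S)) :
    ∃ g : N → FrameCoprod L M, GaloisConnection (biext β) g ∧
      ∀ x y z, rect x y ≤ g z ↔ β x y ≤ z := by
  have m₁ : ∀ x x' y, x ≤ x' → β x y ≤ β x' y := by
    intro x x' y h
    have := h₁ {x, x'} y
    rw [sSup_pair, sup_eq_right.2 h, Set.image_pair, sSup_pair] at this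
    rw [this]; exact le_sup_left
  have m₂ : ∀ x y y', y ≤ y' → β x y ≤ β x y' := by
    intro x y y' h
    have := h₂ x {y, y'}
    rw [sSup_pair, sup_eq_right.2 h, Set.image_pair, sSup_pair] at this
    rw [this]; exact le_sup_left
  refine ⟨fun z => ⟨⟨{p | β p.1 p.2 ≤ z}, ?_⟩, ?_, ?_⟩, ?_, ?_⟩
  · exact fun p q hqp hp => ((m₁ _ _ _ hqp.1).trans (m₂ _ _ _ hqp.2)).trans hp
  · intro S y h
    change β (sSup S) y ≤ z
    rw [h₁]
    refine sSup_le ?_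
    rintro _ ⟨x, hx, rfl⟩
    exact h x hx
  · intro x S h
    change β x (sSup S) ≤ z
    rw [h₂]
    refine sSup_le ?_
    rintro _ ⟨y, hy, rfl⟩
    exact h y hy
  · intro D z
    refine ⟨fun h p hp => (le_sSup ⟨p, hp, rfl⟩ : _ ≤ biext β D).trans h, fun h => sSup_le ?_⟩
    rintro _ ⟨p, hp, rfl⟩
    exact h hp
  · intro x y z
    rw [rect_le_iff]
    rfl

theorem biext_rect (β : L → M → N) (h₁ : ∀ S y, β (sSup S) y = sSup ((fun x => β x y) '' S))
    (h₂ : ∀ x S, β x (sSup S) = sSup (β x '' S)) (x : L) (y : M) :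
    biext β (rect x y) = β x y := by
  obtain ⟨g, gc, hg⟩ := biext_gc β h₁ h₂
  refine eq_of_forall_ge_iff fun z => ?_
  rw [gc, hg]

theorem map_inf_sSup_left (h : FrameHom L N) (k : FrameHom M N) (S : Set L) (y : M) :
    h (sSup S) ⊓ k y = sSup ((fun x => h x ⊓ k y) '' S) := by
  rw [map_sSup, sSup_inf_eq, sSup_image, iSup_image]

theorem map_inf_sSup_right (h : FrameHom L N) (k : FrameHom M N) (x : L) (S : Set M) :
    h x ⊓ k (sSup S) = sSup ((fun y => h x ⊓ k y) '' S) := by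
  rw [map_sSup, inf_sSup_eq, sSup_image, iSup_image]

/-- The copairing `[h, k] : L ⊗ M → N`. -/
def copair (h : FrameHom L N) (k : FrameHom M N) : FrameHom (FrameCoprod L M) N where
  toFun := biext fun x y => h x ⊓ k y
  map_inf' D E := by
    apply le_antisymm
    · refine le_inf ?_ ?_
      · exact sSup_le_sSup (Set.image_mono fun p hp => hp.1)
      · exact sSup_le_sSup (Set.image_mono fun p hp => hp.2)
    · change sSup _ ⊓ sSup _ ≤ sSup _
      rw [sSup_inf_sSup]
      refine iSup₂_le ?_
      rintro ⟨_, _⟩ ⟨⟨p, hp, rfl⟩, ⟨q, hq, rfl⟩⟩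
      refine le_trans (le_of_eq ?_) (le_sSup ⟨p ⊓ q, ⟨?_, ?_⟩, rfl⟩)
      · simp [inf_inf_inf_comm]
      · exact (D : LowerSet (L × M)).lower inf_le_left hp
      · exact (E : LowerSet (L × M)).lower inf_le_right hq
  map_top' := by
    refine le_antisymm le_top (le_trans (le_of_eq ?_) (le_sSup ⟨(⊤, ⊤), trivial, rfl⟩))
    simp
  map_sSup' S := by
    obtain ⟨g, gc, -⟩ := biext_gc (fun x y => h x ⊓ k y) (map_inf_sSup_left h k)
      (map_inf_sSup_right h k)
    rw [gc.l_sSup, sSup_image]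

theorem copair_rect (h : FrameHom L N) (k : FrameHom M N) (x : L) (y : M) :
    copair h k (rect x y) = h x ⊓ k y :=
  biext_rect (fun x y => h x ⊓ k y) (map_inf_sSup_left h k) (map_inf_sSup_right h k) x y

theorem copair_inl (h : FrameHom L N) (k : FrameHom M N) :
    (copair h k).comp (inlHom L M) = h := by
  ext x
  simp [inlHom_apply, copair_rect]

theorem copair_inr (h : FrameHom L N) (k : FrameHom M N) :
    (copair h k).comp (inrHom L M) = k := by
  ext x
  simp [inrHom_apply, copair_rect]

theorem coprod_hom_ext {f g : FrameHom (FrameCoprod L M) N}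
    (h : ∀ x y, f (rect x y) = g (rect x y)) : f = g := by
  ext D
  rw [eq_sSup_rect D, map_sSup, map_sSup, Set.image_image, Set.image_image]
  simp [h]

end Coprod

/-! ## Locale maps, open maps and products of locales -/

/-- The frame of opens of a locale. -/
def Opens (X : Locale.{u}) : Type u := (Opposite.unop (α := Frm.{u}) X).carrier

instance (X : Locale.{u}) : Order.Frame (Opens X) := (Opposite.unop (α := Frm.{u}) X).str

/-- The frame map `f⁻¹` underlying a map of locales. -/
def preimage {X Y : Locale.{u}} (f : X ⟶ Y) : FrameHom (Opens Y) (Opens X) :=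
  (Quiver.Hom.unop (V := Frm.{u}) f).hom

/-- The map of locales with a given underlying frame map. -/
def ofPreimage {X Y : Locale.{u}} (h : FrameHom (Opens Y) (Opens X)) : X ⟶ Y :=
  Quiver.Hom.op (V := Frm.{u}) (Frm.ofHom h)

theorem preimage_ofPreimage {X Y : Locale.{u}} (h : FrameHom (Opens Y) (Opens X)) :
    preimage (ofPreimage h) = h := rfl

theorem hom_ext {X Y : Locale.{u}} {f g : X ⟶ Y} (h : preimage f = preimage g) : f = g :=
  Quiver.Hom.unop_inj (C := Frm.{u}) (Frm.hom_ext h)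

theorem preimage_comp {X Y Z : Locale.{u}} (f : X ⟶ Y) (g : Y ⟶ Z) :
    preimage (f ≫ g) = (preimage f).comp (preimage g) := rfl

theorem preimage_id (X : Locale.{u}) : preimage (𝟙 X) = FrameHom.id (Opens X) := rfl

/-- A locale map `f` is open if `f⁻¹` has a left adjoint satisfying Frobenius reciprocity. -/
def OpenMap {X Y : Locale.{u}} (f : X ⟶ Y) : Prop :=
  ∃ g : Opens X → Opens Y, GaloisConnection g (preimage f) ∧
    ∀ U V, g (U ⊓ preimage f V) = g U ⊓ V

/-- The function `f_!`, given by the formula for the left adjoint of `f⁻¹`; it is the left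
adjoint whenever one exists, see `directImage_eq`. -/
def directImage {X Y : Locale.{u}} (f : X ⟶ Y) (U : Opens X) : Opens Y :=
  sInf {V : Opens Y | U ≤ preimage f V}

theorem directImage_eq {X Y : Locale.{u}} {f : X ⟶ Y} {g : Opens X → Opens Y}
    (gc : GaloisConnection g (preimage f)) : directImage f = g := by
  funext U
  exact le_antisymm (sInf_le (gc.le_u_l U)) (le_sInf fun V hV => gc.l_le hV)

theorem OpenMap.gc {X Y : Locale.{u}} {f : X ⟶ Y} (hf : OpenMap f) :
    GaloisConnection (directImage f) (preimage f) := by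
  obtain ⟨g, gc, -⟩ := hf
  rwa [directImage_eq gc]

theorem OpenMap.frobenius {X Y : Locale.{u}} {f : X ⟶ Y} (hf : OpenMap f) (U : Opens X)
    (V : Opens Y) : directImage f (U ⊓ preimage f V) = directImage f U ⊓ V := by
  obtain ⟨g, gc, hg⟩ := hf
  rw [directImage_eq gc, hg]

/-- The product of two locales. -/
def prodLocale (X Y : Locale.{u}) : Locale.{u} := Locale.of (FrameCoprod (Opens X) (Opens Y))

/-- The first projection. -/
def prFst (X Y : Locale.{u}) : prodLocale X Y ⟶ X := ofPreimage (inlHom (Opens X) (Opens Y))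

/-- The second projection. -/
def prSnd (X Y : Locale.{u}) : prodLocale X Y ⟶ Y := ofPreimage (inrHom (Opens X) (Opens Y))

/-- The pairing of two locale maps. -/
def pair {X Y Z : Locale.{u}} (f : Z ⟶ X) (g : Z ⟶ Y) : Z ⟶ prodLocale X Y :=
  ofPreimage (copair (preimage f) (preimage g))

theorem pair_fst {X Y Z : Locale.{u}} (f : Z ⟶ X) (g : Z ⟶ Y) : pair f g ≫ prFst X Y = f :=
  hom_ext (copair_inl (preimage f) (preimage g))

theorem pair_snd {X Y Z : Locale.{u}} (f : Z ⟶ X) (g : Z ⟶ Y) : pair f g ≫ prSnd X Y = g :=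
  hom_ext (copair_inr (preimage f) (preimage g))

/-- Every frame map out of a coproduct is a copairing. -/
theorem coprod_hom_ext_inj {L M N : Type*} [Order.Frame L] [Order.Frame M] [Order.Frame N]
    {f g : FrameHom (FrameCoprod L M) N} (h₁ : f.comp (inlHom L M) = g.comp (inlHom L M))
    (h₂ : f.comp (inrHom L M) = g.comp (inrHom L M)) : f = g := by
  refine coprod_hom_ext fun x y => ?_
  rw [rect_eq, map_inf, map_inf]
  exact congrArg₂ _ (DFunLike.congr_fun h₁ x) (DFunLike.congr_fun h₂ y)

theorem prod_hom_ext {X Y Z : Locale.{u}} {f g : Z ⟶ prodLocale X Y}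
    (h₁ : f ≫ prFst X Y = g ≫ prFst X Y) (h₂ : f ≫ prSnd X Y = g ≫ prSnd X Y) : f = g :=
  hom_ext (coprod_hom_ext_inj (L := Opens X) (M := Opens Y) (congrArg preimage h₁)
    (congrArg preimage h₂))

/-- The map `f × f`. -/
def prodMap {X Y : Locale.{u}} (f : X ⟶ Y) : prodLocale X X ⟶ prodLocale Y Y :=
  pair (prFst X X ≫ f) (prSnd X X ≫ f)

theorem prodMap_rect {X Y : Locale.{u}} (f : X ⟶ Y) (a b : Opens Y) :
    preimage (prodMap f) (rect a b : FrameCoprod (Opens Y) (Opens Y)) =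
      (rect (preimage f a) (preimage f b) : FrameCoprod (Opens X) (Opens X)) :=
  (copair_rect _ _ a b).trans (rect_eq (preimage f a) (preimage f b)).symm

theorem prodMap_id (X : Locale.{u}) : prodMap (𝟙 X) = 𝟙 _ :=
  hom_ext (coprod_hom_ext (L := Opens X) (M := Opens X) fun x y => prodMap_rect (𝟙 X) x y)

theorem prodMap_comp {X Y Z : Locale.{u}} (f : X ⟶ Y) (g : Y ⟶ Z) :
    prodMap (f ≫ g) = prodMap f ≫ prodMap g :=
  hom_ext (coprod_hom_ext (L := Opens Z) (M := Opens Z) fun x y =>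
    (prodMap_rect (f ≫ g) x y).trans
      ((prodMap_rect f _ _).symm.trans
        (congrArg (preimage (prodMap f)) (prodMap_rect g x y).symm)))

/-! ## Localic relations -/

/-- A localic relation on `X` is a sublocale of `X × X`. -/
abbrev LocalicRel (X : Locale.{u}) : Type u := Sublocale (FrameCoprod (Opens X) (Opens X))

/-- The locale underlying a localic relation. -/
def relLocale {X : Locale.{u}} (R : LocalicRel X) : Locale.{u} := Locale.of R

/-- The sublocale inclusion `r : R ↣ X × X`. -/
def incl {X : Locale.{u}} (R : LocalicRel X) : relLocale R ⟶ prodLocale X X :=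
  ofPreimage R.restrict

/-- The source map `s`. -/
def source {X : Locale.{u}} (R : LocalicRel X) : relLocale R ⟶ X := incl R ≫ prFst X X

/-- The target map `t`. -/
def target {X : Locale.{u}} (R : LocalicRel X) : relLocale R ⟶ X := incl R ≫ prSnd X X

/-- A localic relation has open cones if its source and target maps are open. -/
def HasOpenCones {X : Locale.{u}} (R : LocalicRel X) : Prop :=
  OpenMap (source R) ∧ OpenMap (target R)

/-- The induced up cone `t_! s⁻¹`. -/
def upCone {X : Locale.{u}} (R : LocalicRel X) (U : Opens X) : Opens X :=
  directImage (target R) (preimage (source R) U)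

/-- The induced down cone `s_! t⁻¹`. -/
def downCone {X : Locale.{u}} (R : LocalicRel X) (U : Opens X) : Opens X :=
  directImage (source R) (preimage (target R) U)

/-- The kernel pair `X ×_Q X ↣ X × X` of `q : X ⟶ Q`: the equaliser of `q ∘ pr₁` and `q ∘ pr₂`,
that is, the sublocale obtained by identifying `q⁻¹ V ⊗ ⊤` with `⊤ ⊗ q⁻¹ V`. -/
def kernelPair {X Q : Locale.{u}} (q : X ⟶ Q) : LocalicRel X :=
  saturated fun a b => ∃ V : Opens Q, a = rect (preimage q V) ⊤ ∧ b = rect ⊤ (preimage q V)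

/-- The source and target of the kernel pair are the pullback of `q` along itself. -/
theorem kernelPair_isPullback {X Q : Locale.{u}} (q : X ⟶ Q) :
    IsPullback (source (kernelPair q)) (target (kernelPair q)) q q := by
  have w : source (kernelPair q) ≫ q = target (kernelPair q) ≫ q := by
    refine hom_ext (DFunLike.ext _ _ fun V => ?_)
    exact restrict_saturated_eq ⟨V, rfl, rfl⟩
  have hc : ∀ (Z : Locale.{u}) (f g : Z ⟶ X), f ≫ q = g ≫ q →
      ∃ m : Z ⟶ relLocale (kernelPair q), m ≫ incl (kernelPair q) = pair f g := by
    intro Z f g hfg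
    have hS := apply_restrict_saturated
      (fun a b => ∃ V : Opens Q, a = rect (preimage q V) ⊤ ∧ b = rect ⊤ (preimage q V))
      (copair (preimage f) (preimage g)) (by
        rintro _ _ ⟨V, rfl, rfl⟩
        rw [copair_rect, copair_rect, map_top, map_top, inf_top_eq, top_inf_eq]
        exact DFunLike.congr_fun (congrArg preimage hfg) V)
    exact ⟨ofPreimage (factor (kernelPair q) _ hS), hom_ext (factor_restrict (kernelPair q) _ hS)⟩
  have he : ∀ (Z : Locale.{u}) (m m' : Z ⟶ relLocale (kernelPair q)),
      m ≫ incl (kernelPair q) = m' ≫ incl (kernelPair q) → m = m' := fun Z m m' h =>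
    hom_ext (restrict_hom_ext (kernelPair q) fun x =>
      DFunLike.congr_fun (congrArg preimage h) x)
  choose m hm using hc
  refine ⟨⟨w⟩, ⟨Limits.PullbackCone.IsLimit.mk w (fun c => m _ c.fst c.snd c.condition)
    (fun c => ?_) (fun c => ?_) (fun c l h₁ h₂ => he _ _ _ ?_)⟩⟩
  · rw [source, ← Category.assoc, hm, pair_fst]
  · rw [target, ← Category.assoc, hm, pair_snd]
  · rw [hm]
    refine prod_hom_ext ?_ ?_
    · rw [pair_fst, Category.assoc]; exact h₁
    · rw [pair_snd, Category.assoc]; exact h₂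

/-! ## Cones on frames and the relations they induce -/

section Cones

variable {L : Type*} [Order.Frame L]

/-- Parallel pairs of cones. -/
def Parallel (up down : L → L) : Prop :=
  ∀ x y, up x ⊓ y ≤ up (x ⊓ down y) ∧ x ⊓ down y ≤ down (up x ⊓ y)

/-- Equality of the reduced cones of two rectangles: this is the condition on `a, b, c, d` that
defines `a ⊗ b ∼ c ⊗ d`. -/
def SameCones (up down : L → L) (a b c d : L) : Prop :=
  up a ⊓ b = up c ⊓ d ∧ a ⊓ down b = c ⊓ down d

/-- The relation `∼` on the rectangles of `L ⊗ L` induced by a pair of cones. -/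
def coneSim (up down : L → L) (p q : FrameCoprod L L) : Prop :=
  ∃ a b c d, p = rect a b ∧ q = rect c d ∧ SameCones up down a b c d

/-- The localic relation induced by a pair of cones: the sublocale generated by `∼`. -/
def inducedRel (up down : L → L) : Sublocale (FrameCoprod L L) := saturated (coneSim up down)

/-- Preservation of all joins. -/
def JoinPreserving (f : L → L) : Prop := ∀ S : Set L, f (sSup S) = sSup (f '' S)

theorem JoinPreserving.mono {f : L → L} (hf : JoinPreserving f) {x y : L} (h : x ≤ y) :
    f x ≤ f y := by
  have := hf {x, y}
  rw [sSup_pair, sup_eq_right.2 h, Set.image_pair, sSup_pair] at this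
  rw [this]; exact le_sup_left

variable {up down : L → L}

theorem SameCones.reduce (hp : Parallel up down) (x y : L) :
    SameCones up down x y (x ⊓ down y) (up x ⊓ y) :=
  ⟨le_antisymm (le_inf (hp x y).1 le_rfl) inf_le_right,
    le_antisymm (le_inf le_rfl (hp x y).2) inf_le_left⟩

theorem SameCones.inf_le (hu : JoinPreserving up) (hd : JoinPreserving down)
    (hp : Parallel up down) {a b c d : L} (h : SameCones up down a b c d) (x y : L) :
    up (a ⊓ x) ⊓ (b ⊓ y) ≤ up (c ⊓ x) ⊓ (d ⊓ y) ∧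
      (a ⊓ x) ⊓ down (b ⊓ y) ≤ (c ⊓ x) ⊓ down (d ⊓ y) := by
  have h₁ : (a ⊓ x) ⊓ down (b ⊓ y) ≤ c ⊓ x := by
    refine le_inf ?_ (inf_le_left.trans inf_le_right)
    exact (inf_le_inf inf_le_left (hd.mono inf_le_left)).trans (h.2.le.trans inf_le_left)
  have h₂ : up (a ⊓ x) ⊓ (b ⊓ y) ≤ d ⊓ y := by
    refine le_inf ?_ (inf_le_right.trans inf_le_right)
    exact (inf_le_inf (hu.mono inf_le_left) inf_le_left).trans (h.1.le.trans inf_le_right)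
  have hr := SameCones.reduce hp (a ⊓ x) (b ⊓ y)
  exact ⟨hr.1.le.trans (inf_le_inf (hu.mono h₁) h₂),
    hr.2.le.trans (inf_le_inf h₁ (hd.mono h₂))⟩

theorem SameCones.inf (hu : JoinPreserving up) (hd : JoinPreserving down)
    (hp : Parallel up down) {a b c d : L} (h : SameCones up down a b c d) (x y : L) :
    SameCones up down (a ⊓ x) (b ⊓ y) (c ⊓ x) (d ⊓ y) := by
  have h₁ := SameCones.inf_le hu hd hp h x y
  have h₂ := SameCones.inf_le hu hd hp (a := c) (b := d) ⟨h.1.symm, h.2.symm⟩ x y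
  exact ⟨le_antisymm h₁.1 h₂.1, le_antisymm h₁.2 h₂.2⟩

theorem restrict_inducedRel_eq {a b c d : L} (h : SameCones up down a b c d) :
    (inducedRel up down).restrict (rect a b) = (inducedRel up down).restrict (rect c d) :=
  restrict_saturated_eq ⟨a, b, c, d, rfl, rfl, h⟩

/-- The common construction of the left adjoints of the source and target maps of an induced
relation. -/
theorem inducedRel_adj (β : L → L → L)
    (h₁ : ∀ S y, β (sSup S) y = sSup ((fun x => β x y) '' S))
    (h₂ : ∀ x S, β x (sSup S) = sSup (β x '' S))
    (hsat : ∀ a b c d, SameCones up down a b c d → ∀ x y, β (a ⊓ x) (b ⊓ y) = β (c ⊓ x) (d ⊓ y))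
    (e₁ e₂ : L → L) (hle : ∀ z, β (e₁ z) (e₂ z) ≤ z)
    (hred : ∀ x y z, β x y ≤ z → ∃ a b, SameCones up down x y a b ∧ a ≤ e₁ z ∧ b ≤ e₂ z)
    (hfrob : ∀ x y z, ∃ x' ≤ x, ∃ y' ≤ y, β x' y' = β x y ⊓ z) :
    ∃ g : inducedRel up down → L,
      GaloisConnection g (fun z => (inducedRel up down).restrict (rect (e₁ z) (e₂ z))) ∧
      (∀ D z, g (D ⊓ (inducedRel up down).restrict (rect (e₁ z) (e₂ z))) = g D ⊓ z) ∧
      ∀ x y, g ((inducedRel up down).restrict (rect x y)) = β x y := by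
  obtain ⟨k, gc, hk⟩ := biext_gc β h₁ h₂
  have hs : ∀ z, k z ∈ inducedRel up down := by
    have key : ∀ z a b c d, SameCones up down a b c d → ∀ E : FrameCoprod L L,
        rect a b ⊓ E ≤ k z → rect c d ⊓ E ≤ k z := by
      intro z a b c d h E hE
      rw [eq_sSup_rect E, inf_sSup_eq]
      refine iSup₂_le ?_
      rintro _ ⟨p, hp, rfl⟩
      dsimp only
      rw [rect_inf_rect, hk, ← hsat a b c d h, ← hk, ← rect_inf_rect]
      exact (inf_le_inf_left _ (rect_le_iff.2 hp)).trans hE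
    rintro z _ _ E ⟨a, b, c, d, rfl, rfl, h⟩
    exact ⟨key z a b c d h E, key z c d a b ⟨h.1.symm, h.2.symm⟩ E⟩
  have hkz : ∀ z, ((inducedRel up down).restrict (rect (e₁ z) (e₂ z)) : FrameCoprod L L) = k z := by
    intro z
    apply le_antisymm
    · have : (inducedRel up down).restrict (rect (e₁ z) (e₂ z)) ≤ ⟨k z, hs z⟩ := by
        rw [restrict_le_iff]
        exact (hk _ _ _).2 (hle z)
      exact this
    · rw [eq_sSup_rect (k z)]
      refine sSup_le ?_
      rintro _ ⟨p, hp, rfl⟩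
      obtain ⟨a, b, hab, ha, hb⟩ := hred p.1 p.2 z ((hk _ _ _).1 (rect_le_iff.2 hp))
      dsimp only
      rw [← restrict_le_iff, restrict_inducedRel_eq hab]
      exact OrderHomClass.mono _ (rect_mono ha hb)
  have gc2 : GaloisConnection (fun D : inducedRel up down => biext β (D : FrameCoprod L L))
      (fun z => (inducedRel up down).restrict (rect (e₁ z) (e₂ z))) := by
    intro D z
    rw [gc, ← hkz]
    rfl
  refine ⟨_, gc2, fun D z => ?_, fun x y => ?_⟩
  · apply le_antisymm
    · exact le_inf (gc2.monotone_l inf_le_left) ((gc2 _ _).2 inf_le_right)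
    · change sSup _ ⊓ z ≤ _
      rw [sSup_inf_eq]
      refine iSup₂_le ?_
      rintro _ ⟨p, hp, rfl⟩
      obtain ⟨x', hx, y', hy, h⟩ := hfrob p.1 p.2 z
      refine (le_of_eq h.symm).trans (le_sSup ⟨(x', y'), ?_, rfl⟩)
      have hD : rect x' y' ≤ (D : FrameCoprod L L) :=
        rect_le_iff.2 (LowerSet.lower _ (show (x', y') ≤ p from ⟨hx, hy⟩) hp)
      have hz : rect x' y' ≤
          ((inducedRel up down).restrict (rect (e₁ z) (e₂ z)) : FrameCoprod L L) := by
        rw [hkz, hk, h]; exact inf_le_right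
      exact rect_le_iff.1 (le_inf hD hz)
  · refine eq_of_forall_ge_iff fun z => ?_
    rw [gc2, restrict_le_iff, hkz, hk]

end Cones

section OpenCones

variable {X : Locale.{u}} {up down : Opens X → Opens X}

theorem inducedRel_source (hu : JoinPreserving up) (hd : JoinPreserving down)
    (hp : Parallel up down) :
    OpenMap (source (inducedRel up down)) ∧ ∀ x y, directImage (source (inducedRel up down))
      ((inducedRel up down).restrict (rect x y)) = x ⊓ down y := by
  obtain ⟨g, gc, hf, hg⟩ := inducedRel_adj (up := up) (down := down) (fun x y => x ⊓ down y)
    (fun S y => by rw [sSup_inf_eq, sSup_image])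
    (fun x S => by rw [hd, inf_sSup_eq, sSup_image, iSup_image])
    (fun a b c d h x y => (h.inf hu hd hp x y).2) id (fun _ => ⊤) (fun z => inf_le_left)
    (fun x y z h => ⟨_, _, SameCones.reduce hp x y, h, le_top⟩)
    (fun x y z => ⟨x ⊓ z, inf_le_left, y, le_rfl, inf_right_comm x z (down y)⟩)
  have gc' : GaloisConnection (α := Opens (relLocale (inducedRel up down))) g
      (preimage (source (inducedRel up down))) := gc
  exact ⟨⟨g, gc, hf⟩, by rw [directImage_eq gc']; exact hg⟩

theorem inducedRel_target (hu : JoinPreserving up) (hd : JoinPreserving down)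
    (hp : Parallel up down) :
    OpenMap (target (inducedRel up down)) ∧ ∀ x y, directImage (target (inducedRel up down))
      ((inducedRel up down).restrict (rect x y)) = up x ⊓ y := by
  obtain ⟨g, gc, hf, hg⟩ := inducedRel_adj (up := up) (down := down) (fun x y => up x ⊓ y)
    (fun S y => by rw [hu, sSup_inf_eq, sSup_image, iSup_image])
    (fun x S => by rw [inf_sSup_eq, sSup_image])
    (fun a b c d h x y => (h.inf hu hd hp x y).1) (fun _ => ⊤) id (fun z => inf_le_right)
    (fun x y z h => ⟨_, _, SameCones.reduce hp x y, le_top, h⟩)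
    (fun x y z => ⟨x, le_rfl, y ⊓ z, inf_le_left, (inf_assoc (up x) y z).symm⟩)
  have gc' : GaloisConnection (α := Opens (relLocale (inducedRel up down))) g
      (preimage (target (inducedRel up down))) := gc
  exact ⟨⟨g, gc, hf⟩, by rw [directImage_eq gc']; exact hg⟩

/-- The relation induced by a join-preserving parallel pair of cones has open cones. -/
theorem inducedRel_hasOpenCones (hu : JoinPreserving up) (hd : JoinPreserving down)
    (hp : Parallel up down) : HasOpenCones (inducedRel up down) :=
  ⟨(inducedRel_source hu hd hp).1, (inducedRel_target hu hd hp).1⟩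

theorem upCone_inducedRel (hu : JoinPreserving up) (hd : JoinPreserving down)
    (hp : Parallel up down) : upCone (inducedRel up down) = up :=
  funext fun x => ((inducedRel_target hu hd hp).2 x ⊤).trans (inf_top_eq _)

theorem downCone_inducedRel (hu : JoinPreserving up) (hd : JoinPreserving down)
    (hp : Parallel up down) : downCone (inducedRel up down) = down :=
  funext fun x => ((inducedRel_source hu hd hp).2 ⊤ x).trans (top_inf_eq _)

variable {R : LocalicRel X}

theorem restrict_rect (R : LocalicRel X) (a b : Opens X) :
    R.restrict (rect a b) = preimage (source R) a ⊓ preimage (target R) b := by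
  rw [rect_eq, map_inf]
  rfl

theorem upCone_joinPreserving (hR : HasOpenCones R) : JoinPreserving (upCone R) := by
  intro S
  unfold upCone
  rw [map_sSup, hR.2.gc.l_sSup, sSup_image, iSup_image]

theorem downCone_joinPreserving (hR : HasOpenCones R) : JoinPreserving (downCone R) := by
  intro S
  unfold downCone
  rw [map_sSup, hR.1.gc.l_sSup, sSup_image, iSup_image]

theorem directImage_target_inf (hR : HasOpenCones R) (a b : Opens X) :
    directImage (target R) (preimage (source R) a ⊓ preimage (target R) b) = upCone R a ⊓ b :=
  hR.2.frobenius _ _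

theorem directImage_source_inf (hR : HasOpenCones R) (a b : Opens X) :
    directImage (source R) (preimage (source R) a ⊓ preimage (target R) b) =
      a ⊓ downCone R b := by
  rw [inf_comm, hR.1.frobenius, inf_comm]
  rfl

theorem cones_parallel (hR : HasOpenCones R) : Parallel (upCone R) (downCone R) := by
  intro x y
  constructor
  · rw [← directImage_target_inf hR]
    refine hR.2.gc.monotone_l ?_
    rw [map_inf]
    exact inf_le_inf_left _ (hR.1.gc.le_u_l _)
  · rw [← directImage_source_inf hR]
    refine hR.1.gc.monotone_l ?_
    rw [map_inf]
    exact inf_le_inf_right _ (hR.2.gc.le_u_l _)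

/-- On rectangles, the congruence of a relation with open cones is the relation `∼`. -/
theorem restrict_rect_eq_iff (hR : HasOpenCones R) (a b c d : Opens X) :
    R.restrict (rect a b) = R.restrict (rect c d) ↔
      SameCones (upCone R) (downCone R) a b c d := by
  have hred : ∀ x y : Opens X, R.restrict (rect x y) =
      R.restrict (rect (x ⊓ downCone R y) (upCone R x ⊓ y)) := by
    intro x y
    rw [restrict_rect, restrict_rect, map_inf, map_inf]
    have h₁ : preimage (target R) y ≤ preimage (source R) (downCone R y) := hR.1.gc.le_u_l _
    have h₂ : preimage (source R) x ≤ preimage (target R) (upCone R x) := hR.2.gc.le_u_l _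
    exact le_antisymm (le_inf (le_inf inf_le_left (inf_le_right.trans h₁))
      (le_inf (inf_le_left.trans h₂) inf_le_right)) (inf_le_inf inf_le_left inf_le_right)
  constructor
  · intro h
    rw [restrict_rect, restrict_rect] at h
    rw [SameCones, ← directImage_target_inf hR, ← directImage_target_inf hR,
      ← directImage_source_inf hR, ← directImage_source_inf hR, h]
    exact ⟨rfl, rfl⟩
  · intro h
    rw [hred a b, hred c d, h.1, h.2]

end OpenCones

/-! ## The category of locales equipped with relations -/

/-- A locale equipped with a localic relation. -/
structure RelLoc : Type (u + 1) where
  /-- The underlying locale. -/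
  X : Locale.{u}
  /-- The relation. -/
  rel : LocalicRel X

/-- A locale map `f` is monotone if `f × f` restricts to the relations. -/
def MonotoneMap {A B : RelLoc.{u}} (f : A.X ⟶ B.X) : Prop :=
  ∃ g : relLocale A.rel ⟶ relLocale B.rel, g ≫ incl B.rel = incl A.rel ≫ prodMap f

/-- Monotone maps between locales equipped with localic relations. -/
@[ext]
structure RelLoc.Hom (A B : RelLoc.{u}) : Type u where
  /-- The underlying map of locales. -/
  base : A.X ⟶ B.X
  mono : MonotoneMap base

instance : Category RelLoc.{u} where
  Hom := RelLoc.Hom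
  id A := ⟨𝟙 A.X, 𝟙 _, by rw [prodMap_id, Category.id_comp, Category.comp_id]⟩
  comp f g := ⟨f.base ≫ g.base, by
    obtain ⟨f', hf⟩ := f.mono
    obtain ⟨g', hg⟩ := g.mono
    exact ⟨f' ≫ g', by rw [Category.assoc, hg, ← Category.assoc, hf, Category.assoc,
      prodMap_comp]⟩⟩
  id_comp f := RelLoc.Hom.ext (Category.id_comp f.base)
  comp_id f := RelLoc.Hom.ext (Category.comp_id f.base)
  assoc f g h := RelLoc.Hom.ext (Category.assoc f.base g.base h.base)

/-- The full subcategory of locales equipped with an open cone relation. -/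
abbrev OpenConeLoc : Type (u + 1) :=
  ObjectProperty.FullSubcategory fun A : RelLoc.{u} => HasOpenCones A.rel

/-! ## The category of conic frames -/

/-- A conic frame is a frame with join-preserving parallel cones. -/
structure ConicFrame : Type (u + 1) where
  /-- The underlying frame. -/
  carrier : Type u
  [frame : Order.Frame carrier]
  /-- The up cone. -/
  up : carrier → carrier
  /-- The down cone. -/
  down : carrier → carrier
  up_join : JoinPreserving up
  down_join : JoinPreserving down
  parallel : Parallel up down

attribute [instance] ConicFrame.frame

/-- Conic morphisms between frames with cones. -/
def Conic {L M : Type*} [Order.Frame L] [Order.Frame M] (up down : L → L) (up' down' : M → M)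
    (h : FrameHom L M) : Prop :=
  (∀ x, up' (h x) ≤ h (up x)) ∧ ∀ x, down' (h x) ≤ h (down x)

/-- Conic morphisms. -/
@[ext]
structure ConicFrame.Hom (C D : ConicFrame.{u}) : Type u where
  /-- The underlying frame map. -/
  hom : FrameHom C.carrier D.carrier
  conic : Conic C.up C.down D.up D.down hom

instance : Category ConicFrame.{u} where
  Hom := ConicFrame.Hom
  id C := ⟨FrameHom.id _, fun _ => le_rfl, fun _ => le_rfl⟩
  comp f g := ⟨g.hom.comp f.hom,
    fun x => (g.conic.1 (f.hom x)).trans (OrderHomClass.mono g.hom (f.conic.1 x)),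
    fun x => (g.conic.2 (f.hom x)).trans (OrderHomClass.mono g.hom (f.conic.2 x))⟩

/-- Conic morphisms are the frame maps preserving `∼`. -/
theorem conic_iff {L M : Type*} [Order.Frame L] [Order.Frame M] {up down : L → L}
    {up' down' : M → M} (hp : Parallel up down) (hp' : Parallel up' down')
    (hu' : JoinPreserving up') (hd' : JoinPreserving down') (h : FrameHom L M) :
    Conic up down up' down' h ↔ ∀ a b c d, SameCones up down a b c d →
      SameCones up' down' (h a) (h b) (h c) (h d) := by
  constructor
  · intro hh
    have key : ∀ x y, SameCones up' down' (h x) (h y) (h (x ⊓ down y)) (h (up x ⊓ y)) := by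
      intro x y
      have h₁ : up' (h x) ⊓ h y ≤ h (up x ⊓ y) := by
        rw [map_inf]; exact inf_le_inf_right _ (hh.1 x)
      have h₂ : h x ⊓ down' (h y) ≤ h (x ⊓ down y) := by
        rw [map_inf]; exact inf_le_inf_left _ (hh.2 y)
      have hr := SameCones.reduce hp' (h x) (h y)
      have m₁ : h (x ⊓ down y) ≤ h x := OrderHomClass.mono h inf_le_left
      have m₂ : h (up x ⊓ y) ≤ h y := OrderHomClass.mono h inf_le_right
      exact ⟨le_antisymm (hr.1.le.trans (inf_le_inf (hu'.mono h₂) h₁))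
          (inf_le_inf (hu'.mono m₁) m₂),
        le_antisymm (hr.2.le.trans (inf_le_inf h₂ (hd'.mono h₁)))
          (inf_le_inf m₁ (hd'.mono m₂))⟩
    intro a b c d hs
    have k₁ := key a b
    have k₂ := key c d
    rw [hs.1, hs.2] at k₁
    exact ⟨k₁.1.trans k₂.1.symm, k₁.2.trans k₂.2.symm⟩
  · intro hh
    constructor
    · intro x
      have := (hh _ _ _ _ (SameCones.reduce hp x ⊤)).1
      rw [map_top, inf_top_eq, inf_top_eq] at this
      rw [this]
      exact inf_le_right
    · intro y
      have := (hh _ _ _ _ (SameCones.reduce hp ⊤ y)).2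
      rw [map_top, top_inf_eq, top_inf_eq] at this
      rw [this]
      exact inf_le_left

/-! ## The adjunction between open cone relations and conic frames -/

theorem incl_prodMap_rect {X Y : Locale.{u}} (R : LocalicRel X) (f : X ⟶ Y) (a b : Opens Y) :
    preimage (incl R ≫ prodMap f) (rect a b : FrameCoprod (Opens Y) (Opens Y)) =
      R.restrict (rect (preimage f a) (preimage f b)) :=
  congrArg R.restrict (prodMap_rect f a b)

/-- Monotone maps between open cone relations induce conic morphisms. -/
theorem conic_of_monotone {A B : RelLoc.{u}} (hA : HasOpenCones A.rel) (hB : HasOpenCones B.rel)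
    (f : A.X ⟶ B.X) (hf : MonotoneMap f) :
    Conic (upCone B.rel) (downCone B.rel) (upCone A.rel) (downCone A.rel) (preimage f) := by
  obtain ⟨g, hg⟩ := hf
  rw [conic_iff (cones_parallel hB) (cones_parallel hA) (upCone_joinPreserving hA)
    (downCone_joinPreserving hA)]
  intro a b c d h
  rw [← restrict_rect_eq_iff hB] at h
  rw [← restrict_rect_eq_iff hA, ← incl_prodMap_rect, ← incl_prodMap_rect, ← hg]
  exact congrArg (preimage g) h

/-- A conic morphism is monotone for the induced relation. -/
theorem monotone_of_conic {A : RelLoc.{u}} (hA : HasOpenCones A.rel) {Y : Locale.{u}}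
    {up down : Opens Y → Opens Y} (hp : Parallel up down) (f : A.X ⟶ Y)
    (hf : Conic up down (upCone A.rel) (downCone A.rel) (preimage f)) :
    MonotoneMap (A := A) (B := ⟨Y, inducedRel up down⟩) f := by
  rw [conic_iff hp (cones_parallel hA) (upCone_joinPreserving hA)
    (downCone_joinPreserving hA)] at hf
  have hS := apply_restrict_saturated (coneSim up down)
    (M := Opens (relLocale A.rel)) (preimage (incl A.rel ≫ prodMap f)) (by
      rintro _ _ ⟨a, b, c, d, rfl, rfl, h⟩
      have := (restrict_rect_eq_iff hA _ _ _ _).2 (hf a b c d h)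
      rw [← incl_prodMap_rect, ← incl_prodMap_rect] at this
      exact this)
  exact ⟨ofPreimage (factor (inducedRel up down) _ hS),
    hom_ext (factor_restrict (inducedRel up down) _ hS)⟩

/-- The conic frame of an open cone relation. -/
def conicOf (A : OpenConeLoc.{u}) : ConicFrame.{u} where
  carrier := Opens A.obj.X
  up := upCone A.obj.rel
  down := downCone A.obj.rel
  up_join := upCone_joinPreserving A.property
  down_join := downCone_joinPreserving A.property
  parallel := cones_parallel A.property

/-- The open cone relation of a conic frame. -/
def relOf (C : ConicFrame.{u}) : OpenConeLoc.{u} where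
  obj := ⟨Locale.of C.carrier, inducedRel C.up C.down⟩
  property := inducedRel_hasOpenCones C.up_join C.down_join C.parallel

theorem upCone_relOf (C : ConicFrame.{u}) : upCone (relOf C).obj.rel = C.up :=
  upCone_inducedRel (X := Locale.of C.carrier) C.up_join C.down_join C.parallel

theorem downCone_relOf (C : ConicFrame.{u}) : downCone (relOf C).obj.rel = C.down :=
  downCone_inducedRel (X := Locale.of C.carrier) C.up_join C.down_join C.parallel

theorem OpenConeLoc.hom_ext {A B : OpenConeLoc.{u}} {f g : A ⟶ B}
    (h : f.hom.base = g.hom.base) : f = g :=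
  ObjectProperty.hom_ext _ (RelLoc.Hom.ext h)

/-- The functor `(X, R) ↦ (𝒪 X, ⇑, ⇓)`, `f ↦ f⁻¹`. -/
def coneFunctor : OpenConeLoc.{u} ⥤ ConicFrame.{u}ᵒᵖ where
  obj A := Opposite.op (conicOf A)
  map {A B} f := Quiver.Hom.op (X := conicOf B) (Y := conicOf A)
    ⟨preimage f.hom.base, conic_of_monotone A.property B.property _ f.hom.mono⟩

/-- A conic morphism `C ⟶ (𝒪 X, ⇑, ⇓)`, seen as a monotone map. -/
def toMonotone {A : OpenConeLoc.{u}} {C : ConicFrame.{u}} (h : C ⟶ conicOf A) : A ⟶ relOf C :=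
  ObjectProperty.homMk ⟨ofPreimage (X := A.obj.X) (Y := Locale.of C.carrier) h.hom,
    monotone_of_conic (A := A.obj) (Y := Locale.of C.carrier) A.property C.parallel _ h.conic⟩

/-- A monotone map into an induced relation, seen as a conic morphism. -/
def toConic {A : OpenConeLoc.{u}} {C : ConicFrame.{u}} (f : A ⟶ relOf C) : C ⟶ conicOf A :=
  ⟨preimage f.hom.base, by
    have h := conic_of_monotone A.property (relOf C).property f.hom.base f.hom.mono
    rw [upCone_relOf, downCone_relOf] at h
    exact h⟩

/-- The functor `(𝒪 X, up, down) ↦ (X, R)` with `R` the induced relation, `f⁻¹ ↦ f`. -/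
def relFunctor : ConicFrame.{u}ᵒᵖ ⥤ OpenConeLoc.{u} where
  obj C := relOf C.unop
  map {C _} f := toMonotone (f.unop ≫ toConic (𝟙 (relOf C.unop)))
  map_id _ := OpenConeLoc.hom_ext rfl
  map_comp _ _ := OpenConeLoc.hom_ext rfl

theorem relFunctor_map_base {C D : ConicFrame.{u}ᵒᵖ} (f : C ⟶ D) :
    preimage (relFunctor.map f).hom.base = f.unop.hom := rfl

/-- The adjunction between open cone relations and conic frames. Its unit at `(X, R)` is carried
by the identity map of `X`. -/
def coneRelAdjunction : coneFunctor.{u} ⊣ relFunctor.{u} :=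
  Adjunction.mkOfHomEquiv
    { homEquiv := fun _ _ =>
        { toFun := fun h => toMonotone h.unop
          invFun := fun f => (toConic f).op
          left_inv := fun _ => rfl
          right_inv := fun _ => rfl }
      homEquiv_naturality_left_symm := fun _ _ => rfl
      homEquiv_naturality_right := fun _ _ => rfl }

theorem coneRelAdjunction_unit_base (A : OpenConeLoc.{u}) :
    (coneRelAdjunction.unit.app A).hom.base = 𝟙 A.obj.X := rfl

/-- An open cone relation is a fixed point of the adjunction if the unit is an isomorphism. -/
def IsFixedPoint (A : OpenConeLoc.{u}) : Prop := IsIso (coneRelAdjunction.unit.app A)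

end Localic

/-!
Write `p = q⁻¹ q_!`. By Frobenius reciprocity `(p, p)` is a parallel pair of join-preserving cones,
so `R_{p,p}` has open cones, both equal to `p`, and everything follows from `K = R_{p,p}`. The
kernel pair `K` is the largest relation on which `q ∘ s = q ∘ t`. The relation `R_{p,p}` satisfies
this equation because the cones of the rectangles `q⁻¹ V ⊗ ⊤` and `⊤ ⊗ q⁻¹ V` both reduce to
`p ⊤ ∧ q⁻¹ V`. Conversely, `s⁻¹ U ≤ s⁻¹ (p U) = t⁻¹ (p U)` on `K` and likewise with `s` and `t`
exchanged, so the restriction of a rectangle to `K` depends only on its reduced cones.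
-/

namespace Localic

theorem le_saturated_iff {L : Type*} [Order.Frame L] {r : L → L → Prop} {S : Sublocale L} :
    S ≤ saturated r ↔ ∀ a b, r a b → S.restrict a = S.restrict b := by
  constructor
  · intro h a b hab
    refine eq_of_forall_ge_iff fun s => ?_
    rw [restrict_le_iff, restrict_le_iff]
    simpa only [inf_top_eq] using h s.2 a b ⊤ hab
  · intro h s hs a b c hab
    have inf_le_iff : ∀ x, x ⊓ c ≤ s ↔ S.restrict x ⊓ S.restrict c ≤ ⟨s, hs⟩ := fun x => by
      rw [← map_inf, restrict_le_iff]
    rw [inf_le_iff, inf_le_iff, h a b hab]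

theorem parallel_self_of_inf_le {L : Type*} [Order.Frame L] {c : L → L} (le_c : ∀ x, x ≤ c x)
    (inf_le : ∀ x y, c x ⊓ c y ≤ c (x ⊓ c y)) : Parallel c c := by
  refine fun x y => ⟨(inf_le_inf_left _ (le_c y)).trans (inf_le x y), ?_⟩
  calc x ⊓ c y ≤ c y ⊓ c x := (inf_le_inf_right _ (le_c x)).trans_eq (inf_comm _ _)
    _ ≤ c (y ⊓ c x) := inf_le y x
    _ = c (c x ⊓ y) := by rw [inf_comm]

section Relations

variable {X Q : Locale.{u}} {R S : LocalicRel X}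

theorem le_inducedRel {up down : Opens X → Opens X}
    (source_le : ∀ a, preimage (source R) a ≤ preimage (target R) (up a))
    (target_le : ∀ b, preimage (target R) b ≤ preimage (source R) (down b)) :
    R ≤ inducedRel up down := by
  have restrict_reduce : ∀ a b,
      R.restrict (rect a b) = R.restrict (rect (a ⊓ down b) (up a ⊓ b)) := by
    intro a b
    rw [restrict_rect, restrict_rect, map_inf, map_inf]
    exact le_antisymm
      (le_inf (le_inf inf_le_left (inf_le_right.trans (target_le b)))
        (le_inf (inf_le_left.trans (source_le a)) inf_le_right))
      (inf_le_inf inf_le_left inf_le_right)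
  refine le_saturated_iff.2 ?_
  rintro _ _ ⟨a, b, c, d, rfl, rfl, h⟩
  rw [restrict_reduce a b, restrict_reduce c d, h.1, h.2]

theorem le_kernelPair_iff {q : X ⟶ Q} :
    R ≤ kernelPair q ↔ source R ≫ q = target R ≫ q := by
  refine le_saturated_iff.trans ⟨fun h => ?_, ?_⟩
  · exact hom_ext (FrameHom.ext fun V => h _ _ ⟨V, rfl, rfl⟩)
  · rintro h _ _ ⟨V, rfl, rfl⟩
    exact DFunLike.congr_fun (congrArg preimage h) V

theorem monotoneMap_id_iff_le :
    MonotoneMap (A := ⟨X, R⟩) (B := ⟨X, S⟩) (𝟙 X) ↔ R ≤ S := by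
  constructor
  · rintro ⟨g, hg⟩ r hr
    have restrict_eq : ∀ x, preimage g (S.restrict x) = R.restrict x := fun x => by
      have := DFunLike.congr_fun (congrArg preimage hg) x
      rw [prodMap_id, Category.comp_id] at this
      exact this
    have restrict_le : R.restrict (S.restrict r : FrameCoprod (Opens X) (Opens X)) ≤ ⟨r, hr⟩ := by
      rw [← restrict_eq, restrict_coe, restrict_eq]
      exact (restrict_coe R ⟨r, hr⟩).le
    have coe_restrict : (S.restrict r : FrameCoprod (Opens X) (Opens X)) = r :=
      le_antisymm ((restrict_le_iff _ _ _).1 restrict_le) ((restrict_le_iff _ _ _).1 le_rfl)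
    exact coe_restrict ▸ (S.restrict r).2
  · intro h
    have restrict_restrict : ∀ x,
        R.restrict (S.restrict x : FrameCoprod (Opens X) (Opens X)) = R.restrict x := fun x =>
      eq_of_forall_ge_iff fun r => by
        rw [restrict_le_iff, restrict_le_iff]
        exact restrict_le_iff S x ⟨r, h r.2⟩
    refine ⟨ofPreimage (factor S R.restrict restrict_restrict), ?_⟩
    rw [prodMap_id, Category.comp_id]
    exact hom_ext (factor_restrict S R.restrict restrict_restrict)

end Relations

theorem isFixedPoint_iff (A : OpenConeLoc.{u}) :
    IsFixedPoint A ↔ A.obj.rel = inducedRel (upCone A.obj.rel) (downCone A.obj.rel) := by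
  constructor
  · intro (h : IsIso (coneRelAdjunction.unit.app A))
    have inv_base : (inv (coneRelAdjunction.unit.app A)).hom.base = 𝟙 A.obj.X :=
      congrArg (fun f : A ⟶ A => f.hom.base) (IsIso.hom_inv_id (coneRelAdjunction.unit.app A))
    have unit_mono := (coneRelAdjunction.unit.app A).hom.mono
    have inv_mono := (inv (coneRelAdjunction.unit.app A)).hom.mono
    rw [inv_base] at inv_mono
    exact le_antisymm (monotoneMap_id_iff_le.1 unit_mono) (monotoneMap_id_iff_le.1 inv_mono)
  · intro h
    let unitInv : relOf (conicOf A) ⟶ A :=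
      ObjectProperty.homMk ⟨𝟙 A.obj.X, monotoneMap_id_iff_le.2 h.ge⟩
    exact ⟨unitInv, OpenConeLoc.hom_ext (Category.comp_id (𝟙 A.obj.X)),
      OpenConeLoc.hom_ext (Category.comp_id (𝟙 A.obj.X))⟩

section KernelPair

variable {X Q : Locale.{u}} {q : X ⟶ Q}

/-- The hull `q⁻¹ q_! U` of an open `U` under a locale map `q`: for open `q`, the least open
containing `U` that comes from an open of the codomain. -/
def fiberHull (q : X ⟶ Q) (U : Opens X) : Opens X := preimage q (directImage q U)

theorem le_fiberHull (hq : OpenMap q) (U : Opens X) : U ≤ fiberHull q U := hq.gc.le_u_l U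

theorem fiberHull_inf_preimage (hq : OpenMap q) (U : Opens X) (V : Opens Q) :
    fiberHull q (U ⊓ preimage q V) = fiberHull q U ⊓ preimage q V := by
  rw [fiberHull, hq.frobenius, map_inf, fiberHull]

theorem fiberHull_joinPreserving (hq : OpenMap q) : JoinPreserving (fiberHull q) := fun S => by
  rw [fiberHull, hq.gc.l_sSup, ← sSup_image, map_sSup, Set.image_image]
  rfl

theorem fiberHull_parallel (hq : OpenMap q) : Parallel (fiberHull q) (fiberHull q) :=
  parallel_self_of_inf_le (le_fiberHull hq) fun x _ => (fiberHull_inf_preimage hq x _).ge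

theorem sameCones_fiberHull_preimage (hq : OpenMap q) (V : Opens Q) :
    SameCones (fiberHull q) (fiberHull q) (preimage q V) ⊤ ⊤ (preimage q V) := by
  have hull_preimage : fiberHull q (preimage q V) = fiberHull q ⊤ ⊓ preimage q V := by
    rw [← fiberHull_inf_preimage hq, top_inf_eq]
  exact ⟨by rw [hull_preimage, inf_top_eq], by rw [hull_preimage, top_inf_eq, inf_comm]⟩

theorem kernelPair_eq_inducedRel (hq : OpenMap q) :
    kernelPair q = inducedRel (fiberHull q) (fiberHull q) := by
  apply le_antisymm
  · have source_eq_target : ∀ V, preimage (source (kernelPair q)) (preimage q V) =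
        preimage (target (kernelPair q)) (preimage q V) :=
      DFunLike.congr_fun (congrArg preimage (le_kernelPair_iff.1 le_rfl))
    exact le_inducedRel
      (fun a => (OrderHomClass.mono _ (le_fiberHull hq a)).trans (source_eq_target _).le)
      (fun b => (OrderHomClass.mono _ (le_fiberHull hq b)).trans (source_eq_target _).ge)
  · exact le_kernelPair_iff.2 <| hom_ext <| FrameHom.ext fun V =>
      restrict_inducedRel_eq (sameCones_fiberHull_preimage hq V)

theorem kernelPair_hasOpenCones (hq : OpenMap q) : HasOpenCones (kernelPair q) := by
  rw [kernelPair_eq_inducedRel hq]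
  exact inducedRel_hasOpenCones (fiberHull_joinPreserving hq) (fiberHull_joinPreserving hq)
    (fiberHull_parallel hq)

theorem upCone_kernelPair (hq : OpenMap q) : upCone (kernelPair q) = fiberHull q := by
  rw [kernelPair_eq_inducedRel hq, upCone_inducedRel (fiberHull_joinPreserving hq)
    (fiberHull_joinPreserving hq) (fiberHull_parallel hq)]

theorem downCone_kernelPair (hq : OpenMap q) : downCone (kernelPair q) = fiberHull q := by
  rw [kernelPair_eq_inducedRel hq, downCone_inducedRel (fiberHull_joinPreserving hq)
    (fiberHull_joinPreserving hq) (fiberHull_parallel hq)]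

end KernelPair

end Localic

theorem mainTheorem7 {X Q : Locale.{u}} (q : X ⟶ Q) (hq : Localic.OpenMap q) :
    ∃ h : Localic.HasOpenCones (Localic.kernelPair q),
      (∀ U : Localic.Opens X, Localic.upCone (Localic.kernelPair q) U =
        Localic.preimage q (Localic.directImage q U)) ∧
      (∀ U : Localic.Opens X, Localic.downCone (Localic.kernelPair q) U =
        Localic.preimage q (Localic.directImage q U)) ∧
      Localic.IsFixedPoint ⟨⟨X, Localic.kernelPair q⟩, h⟩ ∧
      Localic.kernelPair q = Localic.inducedRel (Localic.upCone (Localic.kernelPair q))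
        (Localic.downCone (Localic.kernelPair q)) := by
  have kernelPair_eq : Localic.kernelPair q = Localic.inducedRel
      (Localic.upCone (Localic.kernelPair q)) (Localic.downCone (Localic.kernelPair q)) := by
    rw [Localic.upCone_kernelPair hq, Localic.downCone_kernelPair hq]
    exact Localic.kernelPair_eq_inducedRel hq
  exact ⟨Localic.kernelPair_hasOpenCones hq, congrFun (Localic.upCone_kernelPair hq),
    congrFun (Localic.downCone_kernelPair hq), (Localic.isFixedPoint_iff _).2 kernelPair_eq,
    kernelPair_eq⟩
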